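/- Let $(A,\mathfrak m)$ be a (commutative, Noetherian) Cohen--Macaulay local ring of dimension $d\ge 1$. For a maximal Cohen--Macaulay (MCM) $A$-module $X$ (finitely generated, and zero or with $\operatorname{depth} X=d$) put $$e^T_A(X)=\lim_{n\to\infty}\frac{(d-1)!}{n^{d-1}}\,\ell\bigl(\operatorname{Tor}^A_1(X,A/\mathfrak m^{n+1})\bigr).$$ Let $M,N$ be MCM $A$-modules. If $\alpha\in\operatorname{Ext}^1_A(M,N)$ is the class of an extension $0\to N\to E\to M\to 0$ (then $E$ is again MCM), put $e^T_A(\alpha)=e^T_A(M)+e^T_A(N)-e^T_A(E)$, and let $$T_A(M,N)=\{\alpha\in\operatorname{Ext}^1_A(M,N) : e^T_A(\alpha)=0\}.$$ Then $T_A(M,N)$ is an $A$-submodule of $\operatorname{Ext}^1_A(M,N)$, and the quotient $\operatorname{Ext}^1_A(M,N)/T_A(M,N)$ has finite length. -/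

import Mathlib

open CategoryTheory Filter Topology

universe u

noncomputable section

namespace TSplit

/-- The depth of a module over a local ring: the supremum of the lengths of the `M`-regular
sequences contained in the maximal ideal. (With this definition the zero module has depth `0`;
it is treated separately in `IsMCM`.) -/
def depth (A : Type u) [CommRing A] [IsLocalRing A] (M : Type u) [AddCommGroup M] [Module A M] :
    ℕ∞ :=
  ⨆ (rs : List A) (_ : ∀ r ∈ rs, r ∈ IsLocalRing.maximalIdeal A)
    (_ : RingTheory.Sequence.IsRegular M rs), (rs.length : ℕ∞)

/-- A Cohen-Macaulay local ring: a Noetherian local ring whose depth is its Krull dimension. -/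
def IsCohenMacaulay (A : Type u) [CommRing A] [IsLocalRing A] : Prop :=
  IsNoetherianRing A ∧ (depth A A : WithBot ℕ∞) = ringKrullDim A

/-- Maximal Cohen-Macaulay modules: finitely generated modules `M` with `depth M = dim A`;
the zero module is admitted. -/
def IsMCM (A : Type u) [CommRing A] [IsLocalRing A] (M : Type u) [AddCommGroup M] [Module A M] :
    Prop :=
  Module.Finite A M ∧ (Subsingleton M ∨ (depth A M : WithBot ℕ∞) = ringKrullDim A)

/-- The Krull dimension of `A` as a natural number (meaningful when it is finite, as it is for
Noetherian local rings). -/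
def dim (A : Type u) [CommRing A] : ℕ := ((ringKrullDim A).unbotD 0).toNat

/-- `ℓ(Tor₁(M, A/𝔪ⁿ⁺¹))`. -/
def torLength (A : Type u) [CommRing A] [IsLocalRing A] (M : ModuleCat.{u} A) (n : ℕ) : ℕ :=
  (Module.length A
    (((Tor (ModuleCat.{u} A) 1).obj M).obj
      (ModuleCat.of A (A ⧸ IsLocalRing.maximalIdeal A ^ (n + 1))))).toNat

/-- `HasET A M e` says that the limit
`lim_{n → ∞} (d-1)!/n^(d-1) · ℓ(Tor₁(M, A/𝔪ⁿ⁺¹))`, `d = dim A`, exists and equals `e`,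
i.e. that `e^T_A(M) = e`. -/
def HasET (A : Type u) [CommRing A] [IsLocalRing A] (M : ModuleCat.{u} A) (e : ℝ) : Prop :=
  Tendsto
    (fun n : ℕ =>
      ((dim A - 1).factorial : ℝ) / (n : ℝ) ^ (dim A - 1) * (torLength A M n : ℝ))
    atTop (𝓝 e)

/-- A class `α ∈ Ext¹(M, N)` is `T`-split if it is the class of a short exact sequence
`0 → N → E → M → 0` with `e^T(M) + e^T(N) - e^T(E) = 0`. (Two sequences with the same class have
isomorphic middle terms, and every class comes from such a sequence.) -/
def IsTSplit {A : Type u} [CommRing A] [IsLocalRing A] {M N : ModuleCat.{u} A}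
    (α : Abelian.Ext.{u} M N 1) : Prop :=
  ∃ (E : ModuleCat.{u} A) (f : N ⟶ E) (g : E ⟶ M) (w : f ≫ g = 0)
    (hS : (ShortComplex.mk f g w).ShortExact),
    hS.extClass = α ∧
      ∃ eM eN eE : ℝ, HasET A M eM ∧ HasET A N eN ∧ HasET A E eE ∧ eM + eN - eE = 0

end TSplit

end

/-! ### Polynomial growth of integer functions. -/

namespace TSplit

open Polynomial

/-! Fix a presentation 0 → L → F → M → 0 with F finite free. Every class in Ext¹(M, N) is the
pushout of this sequence along some φ : L → N. For the resulting E, the long exact sequence of Tor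
gives ℓTor₁(M) + ℓTor₁(N) - ℓTor₁(E) (all against A/𝔪ⁿ) as the sum, over Q = 𝔪ⁿ and Q = A/𝔪ⁿ, of the
lengths of ker(N ⊗ Q → E ⊗ Q) (`length_ker_lTensor_add`). That kernel is the image of ker(L ⊗ Q → F
⊗ Q) under φ ⊗ Q (`ker_rTensor_eq_map`), so the defect is subadditive in φ and does not grow under
scalars. Hence the φ whose normalized defect tends to 0 form a submodule of Hom(L, N), and T is its
image in Ext¹(M, N). By Artin–Rees, one power of 𝔪 kills ker(L ⊗ Q → F ⊗ Q) for all n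
(`exists_defect_smul_eq_zero`), so it kills Ext¹/T, which is finitely generated. The limits exist
because Tor₁(M, A/𝔪ⁿ) ≅ (𝔪ⁿF ∩ L)/𝔪ⁿL has length eventually polynomial in n, of degree less than dim
A (`exists_polynomial_inf_pow_smul`). -/

/-- Every real polynomial is the difference of one whose degree is larger by at most one. -/
lemma exists_comp_X_add_one_sub (r : ℕ) (P : ℝ[X]) (hP : P.degree < r) :
    ∃ S : ℝ[X], S.degree < (r + 1 : ℕ) ∧ S.comp (X + 1) - S = P := by
  induction r generalizing P with
  | zero =>
    have : P = 0 := ext fun m => by simpa using (degree_lt_iff_coeff_zero P 0).1 hP m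
    exact ⟨0, by simp, by simp [this]⟩
  | succ r ih =>
    -- (X + 1)^(r+1) - X^(r+1) has leading term (r + 1)X^r, so this c cancels the coefficient of X^r
    -- in P.
    set c : ℝ := P.coeff r / (r + 1) with hc
    set S₀ : ℝ[X] := C c * X ^ (r + 1) with hS₀
    have hcomp : S₀.comp (X + 1) - S₀ = C c * ((X + 1) ^ (r + 1) - X ^ (r + 1)) := by
      simp [hS₀, mul_sub]
    obtain ⟨S, hS, hSP⟩ := ih (P - (S₀.comp (X + 1) - S₀)) (by
      rw [degree_lt_iff_coeff_zero] at hP ⊢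
      intro m hm
      rw [hcomp, coeff_sub, coeff_C_mul, coeff_sub, coeff_X_add_one_pow, coeff_X_pow]
      rcases hm.eq_or_lt with rfl | hm
      · have : ((r : ℝ) + 1) ≠ 0 := by positivity
        simp [hc]
        field_simp
        simp
      · rw [hP m hm]
        rcases (Nat.succ_le_of_lt hm).eq_or_lt with h | h
        · simp [← h]
        · rw [Nat.choose_eq_zero_of_lt h, if_neg (by omega)]
          simp)
    refine ⟨S₀ + S, ?_, ?_⟩
    · refine (degree_add_le _ _).trans_lt (max_lt ?_ (hS.trans (by exact_mod_cast (by omega))))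
      refine (degree_C_mul_X_pow_le _ _).trans_lt (by exact_mod_cast (by omega))
    · rw [add_comp, add_sub_add_comm, hSP]
      ring

/-- A sequence whose differences agree eventually with a polynomial does so itself. -/
lemma exists_polynomial_of_sub {f : ℕ → ℝ} {r : ℕ} {P : ℝ[X]} (hP : P.degree < r)
    (h : ∀ᶠ n in atTop, f (n + 1) - f n = P.eval (n : ℝ)) :
    ∃ S : ℝ[X], S.degree < (r + 1 : ℕ) ∧ ∀ᶠ n in atTop, f n = S.eval (n : ℝ) := by
  obtain ⟨S, hS, rfl⟩ := exists_comp_X_add_one_sub r P hP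
  obtain ⟨N, hN⟩ := eventually_atTop.1 h
  refine ⟨S + C (f N - S.eval (N : ℝ)), ?_, eventually_atTop.2 ⟨N, fun n hn => ?_⟩⟩
  · exact (degree_add_le _ _).trans_lt
      (max_lt hS (degree_C_le.trans_lt (by exact_mod_cast (by omega))))
  · induction n, hn using Nat.le_induction with
    | base => simp
    | succ n hn ih =>
      have := hN n hn
      simp only [eval_sub, eval_comp, eval_add, eval_X, eval_one, eval_C] at this ih ⊢
      push_cast
      linarith

/-- A polynomial which is nonnegative and dominated by another one at large natural numbers
has at most its degree. -/
lemma degree_le_of_eventually_le {P Q : ℝ[X]}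
    (h₀ : ∀ᶠ n : ℕ in atTop, 0 ≤ P.eval (n : ℝ))
    (h : ∀ᶠ n : ℕ in atTop, P.eval (n : ℝ) ≤ Q.eval (n : ℝ)) : P.degree ≤ Q.degree := by
  by_contra! hlt
  have hP : P ≠ 0 := by rintro rfl; simp at hlt
  have ht := (div_tendsto_atTop_zero_of_degree_lt Q P hlt).comp
    (tendsto_natCast_atTop_atTop (R := ℝ))
  have hroot := (tendsto_natCast_atTop_atTop (R := ℝ)).eventually (eventually_atTop_not_isRoot P hP)
  obtain ⟨n, h1, h2, h3, h4⟩ := ((ht.eventually (gt_mem_nhds one_pos)).and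
    (h₀.and (h.and hroot))).exists
  have hpos : 0 < P.eval (n : ℝ) := lt_of_le_of_ne h2 (Ne.symm h4)
  simp only [Function.comp] at h1
  rw [div_lt_one hpos] at h1
  linarith

/-- A translation keeps the degree and the leading coefficient, so the top terms cancel. -/
lemma degree_sub_comp_X_sub_lt {H : ℝ[X]} {d : ℕ} (hH : H.degree < (d + 1 : ℕ)) (k : ℝ) :
    (H - H.comp (X - C k)).degree < d := by
  rcases eq_or_ne H 0 with rfl | h0
  · simp
  · have e : H.comp (X - C k) = taylor (-k) H := by simp [taylor_apply, sub_eq_add_neg]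
    rw [e]
    refine (degree_sub_lt_left (degree_taylor H (-k)).symm h0 (by simp)).trans_le ?_
    exact natDegree_le_iff_degree_le.1 (Nat.lt_succ_iff.1 ((natDegree_lt_iff_degree_lt h0).2 hH))

lemma tendsto_eval_div_pow {P : ℝ[X]} {d : ℕ} (hP : P.degree < (d + 1 : ℕ)) :
    ∃ e, Tendsto (fun n : ℕ => P.eval (n : ℝ) / (n : ℝ) ^ d) atTop (𝓝 e) := by
  have hle : P.degree ≤ d := by
    rw [degree_le_iff_coeff_zero]
    exact fun m hm => (degree_lt_iff_coeff_zero _ _).1 hP m (by exact_mod_cast hm)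
  have key : ∃ e, Tendsto (fun x : ℝ => P.eval x / (X ^ d : ℝ[X]).eval x) atTop (𝓝 e) := by
    rcases hle.eq_or_lt with h | h
    · exact ⟨_, div_tendsto_atTop_leadingCoeff_div_of_degree_eq P (X ^ d) (by simpa using h)⟩
    · exact ⟨_, div_tendsto_atTop_zero_of_degree_lt P (X ^ d) (by simpa using h)⟩
  obtain ⟨e, he⟩ := key
  exact ⟨e, by simpa [Function.comp_def] using he.comp (tendsto_natCast_atTop_atTop (R := ℝ))⟩

/-! ### Lengths of subquotients. -/

section RelLength

variable {R M : Type*} [CommRing R] [AddCommGroup M] [Module R M]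

/-- The length of `q / (p ⊓ q)` for submodules `p`, `q` of a module. -/
noncomputable def relLength (p q : Submodule R M) : ℕ∞ :=
  Module.length R (q ⧸ p.submoduleOf q)

lemma relLength_add {p q s : Submodule R M} (hpq : p ≤ q) (hqs : q ≤ s) :
    relLength p s = relLength p q + relLength q s := by
  have h₁ : p.submoduleOf q ≤ (p.submoduleOf s).comap (Submodule.inclusion hqs) := by
    intro x hx
    simpa [Submodule.submoduleOf] using hx
  have h₂ : p.submoduleOf s ≤ q.submoduleOf s := Submodule.comap_mono hpq
  refine Module.length_eq_add_of_exact
    (Submodule.mapQ _ _ (Submodule.inclusion hqs) h₁) (Submodule.factor h₂) ?_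
    (Submodule.factor_surjective _) ?_
  · rw [injective_iff_map_eq_zero]
    intro x hx
    obtain ⟨x, rfl⟩ := Submodule.mkQ_surjective _ x
    simp only [Submodule.mkQ_apply, Submodule.mapQ_apply, Submodule.Quotient.mk_eq_zero] at hx ⊢
    simpa [Submodule.submoduleOf] using hx
  · intro x
    obtain ⟨x, rfl⟩ := Submodule.mkQ_surjective _ x
    have hx : Submodule.factor h₂ ((p.submoduleOf s).mkQ x) = 0 ↔ x.1 ∈ q :=
      Submodule.Quotient.mk_eq_zero (q.submoduleOf s)
    rw [hx, Set.mem_range]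
    constructor
    · intro hx
      exact ⟨Submodule.Quotient.mk ⟨x, hx⟩, rfl⟩
    · rintro ⟨y, hy⟩
      obtain ⟨y, rfl⟩ := Submodule.mkQ_surjective _ y
      rw [Submodule.mkQ_apply, Submodule.mapQ_apply, Submodule.mkQ_apply,
        Submodule.Quotient.eq] at hy
      have := sub_mem y.2 (hpq hy)
      simpa [Submodule.submoduleOf] using this

lemma relLength_le_of_le_left {p q s : Submodule R M} (hpq : p ≤ q) (hqs : q ≤ s) :
    relLength q s ≤ relLength p s := by
  rw [relLength_add hpq hqs]; exact le_add_self

lemma relLength_le_of_le_right {p q s : Submodule R M} (hpq : p ≤ q) (hqs : q ≤ s) :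
    relLength p q ≤ relLength p s := by
  rw [relLength_add hpq hqs]; exact le_self_add

lemma relLength_self_of_le {p q : Submodule R M} (h : q ≤ p) : relLength p q = 0 := by
  rw [relLength, Module.length_eq_zero_iff, Submodule.Quotient.subsingleton_iff]
  exact Submodule.submoduleOf_eq_top.2 h

/-- Multiplication by `x` identifies `G / (x⁻¹ F ⊓ G)` with `(F + x G) / F`. -/
lemma relLength_smul (x : R) (F G : Submodule R M) :
    relLength (G ⊓ F.comap (LinearMap.lsmul R M x)) G =
      relLength F (F ⊔ G.map (LinearMap.lsmul R M x)) := by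
  set D := F ⊔ G.map (LinearMap.lsmul R M x)
  have hx : ∀ g ∈ G, LinearMap.lsmul R M x g ∈ D := fun g hg =>
    (le_sup_right : _ ≤ D) ⟨g, hg, rfl⟩
  let φ : G →ₗ[R] D ⧸ F.submoduleOf D :=
    (F.submoduleOf D).mkQ ∘ₗ (LinearMap.lsmul R M x).restrict hx
  have hφ : Function.Surjective φ := by
    intro y
    obtain ⟨⟨y, hy⟩, rfl⟩ := Submodule.mkQ_surjective _ y
    obtain ⟨f, hf, _, ⟨g, hg, rfl⟩, rfl⟩ := Submodule.mem_sup.1 hy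
    refine ⟨⟨g, hg⟩, ?_⟩
    simp only [φ, LinearMap.comp_apply, Submodule.mkQ_apply]
    rw [Submodule.Quotient.eq]
    simpa [Submodule.submoduleOf] using hf
  have hk : (G ⊓ F.comap (LinearMap.lsmul R M x)).submoduleOf G = LinearMap.ker φ := by
    ext g
    rw [LinearMap.mem_ker, LinearMap.comp_apply, Submodule.mkQ_apply,
      Submodule.Quotient.mk_eq_zero]
    simp [Submodule.submoduleOf]
  exact LinearEquiv.length_eq
    ((Submodule.quotEquivOfEq _ _ hk).trans (φ.quotKerEquivOfSurjective hφ))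

end RelLength

end TSplit

namespace TSplit

open Polynomial

/-! ### Hilbert–Serre for pairs of filtrations. -/

section Filtration

variable {R M : Type*} [CommRing R] [AddCommGroup M] [Module R M] {I : Ideal R}

/-- The elements of `G` which multiplication by `x` sends into `F`, in each degree. -/
def kerFiltration (F G : I.Filtration M) (x : R) : I.Filtration M where
  N n := G.N n ⊓ (F.N (n + 1)).comap (LinearMap.lsmul R M x)
  mono n := inf_le_inf (G.mono n) (Submodule.comap_mono (F.mono (n + 1)))
  smul_le n := by
    refine le_inf ((Submodule.smul_mono le_rfl inf_le_left).trans (G.smul_le n)) ?_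
    rw [Submodule.smul_le]
    rintro a ha v ⟨-, hv⟩
    simp only [Submodule.comap_coe, Set.mem_preimage, SetLike.mem_coe, Submodule.mem_comap,
      LinearMap.lsmul_apply] at hv ⊢
    rw [smul_comm]
    exact F.smul_le (n + 1) (Submodule.smul_mem_smul ha hv)

/-- The filtration `F n + x G (n - 1)`. -/
def sumFiltration (F G : I.Filtration M) (x : R) : I.Filtration M where
  -- In degree 0 truncated subtraction gives F 0 + x G 0, which is harmless for asymptotics.
  N n := F.N n ⊔ (G.N (n - 1)).map (LinearMap.lsmul R M x)
  mono n := sup_le_sup (F.mono n) (Submodule.map_mono (G.antitone (by omega)))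
  smul_le n := by
    rw [Submodule.smul_sup]
    refine sup_le_sup (F.smul_le n) ?_
    rw [Submodule.smul_le]
    rintro a ha _ ⟨v, hv, rfl⟩
    refine ⟨a • v, ?_, map_smul _ a v⟩
    rcases n with _ | n
    · exact Submodule.smul_mem _ _ hv
    · exact G.smul_le n (Submodule.smul_mem_smul ha hv)

/-- **Hilbert–Serre**: let `F ≤ G` be `I`-filtrations, `G` stable, such that `I` is generated by a
finite set `S` together with an ideal which kills `G / F`. If the quotients `G n / F n` have finite
length, then their lengths agree for large `n` with a polynomial of degree less than `#S`. -/
theorem exists_polynomial_relLength [IsNoetherianRing R] [Module.Finite R M] (S : Finset R)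
    (hSI : ∀ x ∈ S, x ∈ I) (J : Ideal R) (hI : I ≤ Ideal.span S ⊔ J) (F G : I.Filtration M)
    (hFG : F ≤ G) (hG : G.Stable) (hJ : ∀ n, J • G.N n ≤ F.N (n + 1))
    (hfin : ∀ n, relLength (F.N n) (G.N n) ≠ ⊤) :
    ∃ P : ℝ[X], P.degree < S.card ∧
      ∀ᶠ n in atTop, ((relLength (F.N n) (G.N n)).toNat : ℝ) = P.eval (n : ℝ) := by
  classical
  -- J, F and G vary because the kernel and cokernel of x on G/F are again quotients of filtrations,
  -- killed by x as well, so x moves from S into J.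
  induction S using Finset.induction_on generalizing J F G with
  | empty =>
    obtain ⟨n₀, h₀⟩ := hG
    refine ⟨0, by simp, eventually_atTop.2 ⟨n₀ + 1, fun n hn => ?_⟩⟩
    obtain ⟨n, rfl⟩ : ∃ k, n = k + 1 := ⟨n - 1, by omega⟩
    have : G.N (n + 1) ≤ F.N (n + 1) := by
      rw [← h₀ n (by omega)]
      exact (Submodule.smul_mono_left (by simpa using hI)).trans (hJ n)
    simp [relLength_self_of_le this]
  | insert x S hxS ih =>
    have hx : x ∈ I := hSI x (Finset.mem_insert_self _ _)
    have hSI' : ∀ y ∈ S, y ∈ I := fun y hy => hSI y (Finset.mem_insert_of_mem hy)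
    have hI' : I ≤ Ideal.span S ⊔ (Ideal.span {x} ⊔ J) := by
      refine hI.trans (le_of_eq ?_)
      rw [Finset.coe_insert, Ideal.span_insert, ← sup_assoc, sup_comm (Ideal.span (S : Set R))]
    -- K n / F n is the kernel of x : G n / F n → G (n+1) / F (n+1), and G (n+1) / D (n+1) is its
    -- cokernel.
    set K := kerFiltration F G x with hK
    set D := sumFiltration F G x with hD
    have hFK : ∀ n, F.N n ≤ K.N n := fun n =>
      le_inf (hFG n) fun v hv => F.smul_le n (Submodule.smul_mem_smul hx hv)
    have hKG : ∀ n, K.N n ≤ G.N n := fun n => inf_le_left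
    have hFD : ∀ n, F.N n ≤ D.N n := fun n => le_sup_left
    have hDG : ∀ n, D.N n ≤ G.N n := by
      intro n
      refine sup_le (hFG n) ?_
      rintro _ ⟨v, hv, rfl⟩
      rcases n with _ | n
      · exact Submodule.smul_mem _ _ hv
      · exact G.smul_le n (Submodule.smul_mem_smul hx hv)
    have hxJ : ∀ p q : Submodule R M, p.map (LinearMap.lsmul R M x) ≤ q → J • p ≤ q →
        (Ideal.span {x} ⊔ J) • p ≤ q := by
      intro p q h₁ h₂
      rw [Submodule.sup_smul]
      refine sup_le ?_ h₂
      rw [Submodule.ideal_span_singleton_smul]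
      exact h₁
    have hfK : ∀ n, relLength (F.N n) (K.N n) ≠ ⊤ := fun n =>
      ne_top_of_le_ne_top (hfin n) (relLength_le_of_le_right (hFK n) (hKG n))
    have hfD : ∀ n, relLength (D.N n) (G.N n) ≠ ⊤ := fun n =>
      ne_top_of_le_ne_top (hfin n) (relLength_le_of_le_left (hFD n) (hDG n))
    -- K is stable as a filtration inside the stable G; this uses that R is Noetherian and M finite.
    obtain ⟨P₁, hP₁, h₁⟩ := ih hSI' _ hI' F K hFK (hG.of_le hKG) (fun n => hxJ _ _
      (Submodule.map_le_iff_le_comap.2 inf_le_right)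
      ((Submodule.smul_mono le_rfl (hKG n)).trans (hJ n))) hfK
    obtain ⟨P₂, hP₂, h₂⟩ := ih hSI' _ hI' D G hDG hG (fun n => hxJ _ _
      le_sup_right ((hJ n).trans (hFD _))) hfD
    rw [Finset.card_insert_of_notMem hxS]
    have hdeg : (P₂.comp (X + 1) - P₁).degree < S.card := by
      refine (degree_sub_le _ _).trans_lt (max_lt ?_ hP₁)
      rwa [show P₂.comp (X + 1) = taylor 1 P₂ by simp [taylor_apply], degree_taylor]
    -- The length in degree n + 1 minus that in degree n is cokernel minus kernel, i.e. P₂(n+1) -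
    -- P₁(n).
    refine exists_polynomial_of_sub hdeg ?_
    filter_upwards [h₁, (tendsto_add_atTop_nat 1).eventually h₂] with n e₁ e₂
    have hK' := relLength_add (hFK n) (hKG n)
    have hD' := relLength_add (hFD (n + 1)) (hDG (n + 1))
    have hiso : relLength (K.N n) (G.N n) = relLength (F.N (n + 1)) (D.N (n + 1)) :=
      relLength_smul x (F.N (n + 1)) (G.N n)
    have hfi : relLength (K.N n) (G.N n) ≠ ⊤ :=
      ne_top_of_le_ne_top (hfin n) (relLength_le_of_le_left (hFK n) (hKG n))
    rw [hK', hD', ← hiso, ENat.toNat_add hfi (hfD _), ENat.toNat_add (hfK n) hfi]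
    simp only [eval_sub, eval_comp, eval_add, eval_X, eval_one]
    rw [← e₁]
    push_cast at e₂ ⊢
    rw [← e₂]
    ring

end Filtration

/-! ### Hilbert–Samuel functions and Artin–Rees over a local ring. -/

section Local

variable {A : Type u} [CommRing A] [IsLocalRing A] [IsNoetherianRing A]

open IsLocalRing

/-- A finitely generated module over a Noetherian local ring killed by a power of the maximal ideal
has finite length. -/
lemma isFiniteLength_of_pow_smul {X : Type*} [AddCommGroup X] [Module A X]
    [Module.Finite A X] (k : ℕ) (h : ∀ a ∈ maximalIdeal A ^ k, ∀ x : X, a • x = 0) :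
    IsFiniteLength A X := by
  rw [isFiniteLength_iff_isNoetherian_isArtinian]
  refine ⟨inferInstance, ?_⟩
  rcases subsingleton_or_nontrivial (A ⧸ maximalIdeal A ^ k) with hs | hs
  · have : Subsingleton X := by
      rw [Ideal.Quotient.subsingleton_iff] at hs
      exact ⟨fun x y => by
        rw [← one_smul A x, ← one_smul A y, h 1 (by simp [hs]), h 1 (by simp [hs])]⟩
    infer_instance
  have : IsLocalRing (A ⧸ maximalIdeal A ^ k) :=
    IsLocalRing.of_surjective' _ Ideal.Quotient.mk_surjective
  have hart : IsArtinianRing (A ⧸ maximalIdeal A ^ k) := by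
    rw [isArtinianRing_iff_isNilpotent_maximalIdeal]
    refine ⟨k, ?_⟩
    have : maximalIdeal (A ⧸ maximalIdeal A ^ k) ≤
        (maximalIdeal A).map (Ideal.Quotient.mk (maximalIdeal A ^ k)) := by
      intro y hy
      obtain ⟨y, rfl⟩ := Ideal.Quotient.mk_surjective y
      refine Ideal.mem_map_of_mem _ ?_
      rw [mem_maximalIdeal, mem_nonunits_iff] at hy ⊢
      exact fun hu => hy (hu.map _)
    refine le_bot_iff.1 ((Ideal.pow_right_mono this k).trans ?_)
    rw [← Ideal.map_pow, Ideal.map_quotient_self]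
  have hann : Module.IsTorsionBySet A X (maximalIdeal A ^ k : Ideal A) := fun x a => h a a.2 x
  let := hann.module
  have : IsScalarTower A (A ⧸ maximalIdeal A ^ k) X := hann.isScalarTower
  have : Module.Finite (A ⧸ maximalIdeal A ^ k) X := Module.Finite.of_restrictScalars_finite A _ _
  have : IsArtinian (A ⧸ maximalIdeal A ^ k) X := inferInstance
  exact (LinearMap.isArtinian_iff_of_bijective (S := A ⧸ maximalIdeal A ^ k) (P := X)
    (σ := Ideal.Quotient.mk (maximalIdeal A ^ k))
    { toFun := id, map_add' := fun _ _ => rfl, map_smul' := fun _ _ => rfl }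
    Function.bijective_id).2 inferInstance

lemma relLength_ne_top {X : Type*} [AddCommGroup X] [Module A X]
    [Module.Finite A X] (k : ℕ) {p q : Submodule A X} (h : maximalIdeal A ^ k • q ≤ p) :
    relLength p q ≠ ⊤ := by
  rw [relLength, Module.length_ne_top_iff]
  refine isFiniteLength_of_pow_smul k fun a ha x => ?_
  obtain ⟨x, rfl⟩ := Submodule.mkQ_surjective _ x
  rw [← map_smul, Submodule.mkQ_apply, Submodule.Quotient.mk_eq_zero]
  exact h (Submodule.smul_mem_smul ha x.2)

variable {V : Type*} [AddCommGroup V] [Module A V] [Module.Finite A V]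

/-- The Hilbert–Samuel function of a module with respect to an ideal which is primary to the
maximal ideal is eventually polynomial, of degree at most the number of generators of the ideal. -/
theorem exists_polynomial_hilbertSamuel (L : Submodule A V) (S : Finset A) {k : ℕ}
    (hk : maximalIdeal A ^ k ≤ Ideal.span S) :
    ∃ P : ℝ[X], P.degree < (S.card + 1 : ℕ) ∧ ∀ᶠ n : ℕ in atTop,
      ((relLength (Ideal.span (S : Set A) ^ n • L) L).toNat : ℝ) = P.eval (n : ℝ) := by
  set I := Ideal.span (S : Set A)
  have hsucc : ∀ n, I ^ n • I • L = I ^ (n + 1) • L := fun n => by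
    rw [← mul_smul, pow_succ]
  have hle : ∀ n, I ^ (n + 1) • L ≤ I ^ n • L := fun n =>
    Submodule.smul_mono_left (Ideal.pow_le_pow_right n.le_succ)
  have hfin : ∀ n, relLength (I ^ (n + 1) • L) (I ^ n • L) ≠ ⊤ := fun n =>
    relLength_ne_top k (by
      rw [pow_succ', mul_smul]
      exact Submodule.smul_mono_left hk)
  have hfin' : ∀ n, relLength (I ^ n • L) L ≠ ⊤ := fun n =>
    relLength_ne_top (k * n) (by
      rw [pow_mul]
      exact Submodule.smul_mono_left (Ideal.pow_right_mono hk n))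
  -- Apply Hilbert–Serre to the graded pieces IⁿL / Iⁿ⁺¹L; summing them then raises the degree bound
  -- by one.
  obtain ⟨P, hP, h⟩ := exists_polynomial_relLength (M := V) (I := I) S
    (fun x hx => Ideal.subset_span hx) ⊥ (by simp [I]) (I.stableFiltration (I • L))
    (I.stableFiltration L) (fun n => (hsucc n).trans_le (hle n))
    (I.stableFiltration_stable L) (fun n => by simp)
    (fun n => by simpa [hsucc] using hfin n)
  refine exists_polynomial_of_sub hP ?_
  filter_upwards [h] with n hn
  rw [← hn, relLength_add (hle n) Submodule.smul_le_right, ENat.toNat_add (hfin n) (hfin' n)]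
  simp [hsucc]

/-- A form of the Artin–Rees lemma. -/
lemma exists_pow_smul_inf_le (L : Submodule A V) : ∃ k : ℕ,
    (∀ n, maximalIdeal A ^ k • (maximalIdeal A ^ n • (⊤ : Submodule A V) ⊓ L) ≤
      maximalIdeal A ^ n • L) ∧
    ∀ n ≥ k, maximalIdeal A ^ n • (⊤ : Submodule A V) ⊓ L ≤ maximalIdeal A ^ (n - k) • L := by
  obtain ⟨k, hk⟩ := (maximalIdeal A).exists_pow_inf_eq_pow_smul L
  have h₂ : ∀ n ≥ k, maximalIdeal A ^ n • (⊤ : Submodule A V) ⊓ L ≤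
      maximalIdeal A ^ (n - k) • L := fun n hn => by
    rw [hk n hn]
    exact Submodule.smul_mono le_rfl inf_le_right
  refine ⟨k, fun n => ?_, h₂⟩
  refine le_trans (le_inf ?_ ?_) ((h₂ (n + k) (by omega)).trans (by simp))
  · rw [add_comm, pow_add, mul_smul]
    exact Submodule.smul_mono le_rfl inf_le_left
  · exact Submodule.smul_le_right.trans inf_le_right

/-- 𝔪 is minimal over an ideal generated by ht 𝔪 = dim A elements. Every prime lies in 𝔪, so by
minimality 𝔪 is the only prime over that ideal. -/
lemma exists_systemOfParameters : ∃ (S : Finset A) (k : ℕ), S.card = dim A ∧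
    Ideal.span (S : Set A) ≤ maximalIdeal A ∧ maximalIdeal A ^ k ≤ Ideal.span S := by
  obtain ⟨S, hS, hc⟩ := (maximalIdeal A).exists_finset_card_eq_height_of_isNoetherianRing
  have hrad : maximalIdeal A ≤ (Ideal.span (S : Set A)).radical := by
    rw [Ideal.radical_eq_sInf]
    refine le_sInf fun p ⟨hp, hprime⟩ => ?_
    exact hS.2 ⟨hprime, hp⟩ (le_maximalIdeal hprime.ne_top)
  obtain ⟨k, hk⟩ := Ideal.exists_pow_le_of_le_radical_of_fg hrad (IsNoetherian.noetherian _)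
  refine ⟨S, k, ?_, hS.1.2, hk⟩
  rw [dim, ← maximalIdeal_height_eq_ringKrullDim, ← hc]
  rfl

/-- The length of `(𝔪ⁿ V ⊓ L) / 𝔪ⁿ L` is eventually a polynomial of degree less than `dim A`. -/
theorem exists_polynomial_inf_pow_smul (L : Submodule A V) :
    ∃ P : ℝ[X], P.degree < dim A ∧ ∀ᶠ n : ℕ in atTop,
      ((relLength (maximalIdeal A ^ n • L) (maximalIdeal A ^ n • ⊤ ⊓ L)).toNat : ℝ) =
        P.eval (n : ℝ) := by
  set m := maximalIdeal A
  obtain ⟨k, hk₁, hk₂⟩ := exists_pow_smul_inf_le L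
  obtain ⟨T, hT⟩ := (IsNoetherian.noetherian m : m.FG)
  have hTm : Ideal.span (T : Set A) = m := hT
  -- The degree bound #T is discarded, since 𝔪 may need more than dim A generators. The bound comes
  -- instead from 𝔪ⁿV ∩ L ≤ 𝔪ⁿ⁻ᵏL, whose length over 𝔪ⁿL is H(n) - H(n-k).
  obtain ⟨P, -, hP⟩ := exists_polynomial_relLength (M := V) (I := m) T
    (fun x hx => hTm ▸ Ideal.subset_span hx) ⊥ (by simp [hTm]) (m.stableFiltration L)
    (m.stableFiltration ⊤ ⊓ m.trivialFiltration L)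
    (fun n => le_inf (Submodule.smul_mono le_rfl le_top) Submodule.smul_le_right)
    ((m.stableFiltration_stable ⊤).inter_right _) (fun n => by simp)
    (fun n => relLength_ne_top k (hk₁ n))
  refine ⟨P, ?_, hP⟩
  obtain ⟨H, -, hH⟩ := exists_polynomial_hilbertSamuel (k := 1) L T (by simp [hTm, m])
  rw [hTm] at hH
  obtain ⟨S, j, hS, hSm, hj⟩ := exists_systemOfParameters (A := A)
  obtain ⟨H', hH'deg, hH'⟩ := exists_polynomial_hilbertSamuel L S hj
  rw [hS] at hH'deg
  have hm : ∀ i j : ℕ, i ≤ j → m ^ j • L ≤ m ^ i • L := fun i j hij =>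
    Submodule.smul_mono_left (Ideal.pow_le_pow_right hij)
  have hmL : ∀ i, m ^ i • L ≤ L := fun i => Submodule.smul_le_right
  have hfin : ∀ n, relLength (m ^ n • L) L ≠ ⊤ := fun n => relLength_ne_top n le_rfl
  -- The parameter ideal lies in 𝔪, so its Hilbert–Samuel function dominates that of 𝔪 and has
  -- degree at most dim A.
  have hHH' : H.degree ≤ H'.degree := by
    refine degree_le_of_eventually_le ?_ ?_
    · filter_upwards [hH] with n hn
      rw [← hn]
      positivity
    · filter_upwards [hH, hH'] with n hn hn'
      rw [← hn, ← hn', Nat.cast_le]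
      refine ENat.toNat_le_toNat (relLength_le_of_le_left
        (Submodule.smul_mono_left (Ideal.pow_right_mono hSm n)) (hmL n)) ?_
      exact relLength_ne_top (j * n) (by
        rw [pow_mul]
        exact Submodule.smul_mono_left (Ideal.pow_right_mono hj n))
  refine lt_of_le_of_lt (degree_le_of_eventually_le ?_ ?_)
    (degree_sub_comp_X_sub_lt (hHH'.trans_lt hH'deg) (k : ℝ))
  · filter_upwards [hP] with n hn
    rw [← hn]
    positivity
  · filter_upwards [hP, hH, (tendsto_sub_atTop_nat k).eventually hH, eventually_ge_atTop k]
      with n hn h₁ h₂ hkn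
    have hadd := relLength_add (hm (n - k) n (Nat.sub_le n k)) (hmL (n - k))
    have hfin' : relLength (m ^ n • L) (m ^ (n - k) • L) ≠ ⊤ :=
      ne_top_of_le_ne_top (hfin n) (hadd ▸ le_self_add)
    have hle : relLength (m ^ n • L) (m ^ n • ⊤ ⊓ L) ≤ relLength (m ^ n • L) (m ^ (n - k) • L) :=
      relLength_le_of_le_right (le_inf (Submodule.smul_mono le_rfl le_top) (hmL n)) (hk₂ n hkn)
    rw [hadd, ENat.toNat_add hfin' (hfin _)] at h₁
    rw [Nat.cast_sub hkn] at h₂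
    simp only [eval_sub, eval_comp, eval_X, eval_C]
    rw [← h₁, ← h₂, ← hn]
    push_cast
    rw [add_sub_cancel_right, Nat.cast_le]
    exact ENat.toNat_le_toNat hle hfin'

theorem exists_tendsto_inf_pow_smul (hd : 1 ≤ dim A) (L : Submodule A V) :
    ∃ e : ℝ, Tendsto (fun n : ℕ => ((dim A - 1).factorial : ℝ) / (n : ℝ) ^ (dim A - 1) *
      ((relLength (maximalIdeal A ^ (n + 1) • L)
        (maximalIdeal A ^ (n + 1) • ⊤ ⊓ L)).toNat : ℝ)) atTop (𝓝 e) := by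
  obtain ⟨P, hdeg, hP⟩ := exists_polynomial_inf_pow_smul L
  have hdeg' : (P.comp (X + 1)).degree < (dim A - 1 + 1 : ℕ) := by
    rwa [show P.comp (X + 1) = taylor 1 P by simp [taylor_apply], degree_taylor,
      Nat.sub_add_cancel hd]
  obtain ⟨e, he⟩ := tendsto_eval_div_pow hdeg'
  refine ⟨(dim A - 1).factorial * e, (he.const_mul _).congr' ?_⟩
  filter_upwards [(tendsto_add_atTop_nat 1).eventually hP] with n hn
  rw [hn]
  simp only [eval_comp, eval_add, eval_X, eval_one]
  push_cast
  ring

end Local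

end TSplit

namespace TSplit

open TensorProduct

/-! ### Tor₁ as a kernel of tensor products: connecting map, balance, additivity defect. -/

section Tensor

variable {A : Type*} [CommRing A]
  {N E M : Type*} [AddCommGroup N] [Module A N] [AddCommGroup E] [Module A E]
  [AddCommGroup M] [Module A M]
  {Z P Q : Type*} [AddCommGroup Z] [Module A Z] [AddCommGroup P] [Module A P]
  [AddCommGroup Q] [Module A Q]

/-- The map induced by `f` on the kernels of `- ⊗ Z → - ⊗ P`. -/
noncomputable def kerMap (f : N →ₗ[A] E) (j : Z →ₗ[A] P) :
    LinearMap.ker (j.lTensor N) →ₗ[A] LinearMap.ker (j.lTensor E) :=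
  (f.rTensor Z).restrict fun x hx => by
    rw [LinearMap.mem_ker] at hx ⊢
    rw [← LinearMap.comp_apply, LinearMap.lTensor_comp_rTensor, ← LinearMap.rTensor_comp_lTensor,
      LinearMap.comp_apply, hx, map_zero]

variable {f : N →ₗ[A] E} {g : E →ₗ[A] M} {j : Z →ₗ[A] P} {p : P →ₗ[A] Q}

/-- The connecting homomorphism of the long exact sequence of `Tor`, in low degrees. -/
lemma exists_connecting [Module.Flat A P] (hf : Function.Injective f) (hfg : Function.Exact f g)
    (hg : Function.Surjective g) (hjp : Function.Exact j p) (hp : Function.Surjective p) :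
    ∃ δ : LinearMap.ker (j.lTensor M) →ₗ[A] N ⊗[A] Q,
      Function.Exact (kerMap g j) δ ∧ Function.Exact δ (f.rTensor Q) := by
  have hs := LinearMap.rTensor_surjective Z hg
  have hi := Module.Flat.rTensor_preserves_injective_linearMap (M := P) f hf
  have h₁ : (f.rTensor P).comp (j.lTensor N) = (j.lTensor E).comp (f.rTensor Z) := by
    rw [LinearMap.lTensor_comp_rTensor, LinearMap.rTensor_comp_lTensor]
  have h₂ : (g.rTensor P).comp (j.lTensor E) = (j.lTensor M).comp (g.rTensor Z) := by
    rw [LinearMap.lTensor_comp_rTensor, LinearMap.rTensor_comp_lTensor]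
  -- The rows are - ⊗ Z and - ⊗ P applied to N → E → M; the columns have cokernels - ⊗ Q. Flatness
  -- of P makes the lower row left exact.
  let δ := SnakeLemma.δ (j.lTensor N) (j.lTensor E) (j.lTensor M) (f.rTensor Z) (g.rTensor Z)
    (rTensor_exact Z hfg hg) (f.rTensor P) (g.rTensor P) (rTensor_exact P hfg hg) h₁ h₂
    (Function.surjInv hs) (funext (Function.surjInv_eq hs))
    (Function.invFun (f.rTensor P)) (funext (Function.leftInverse_invFun hi))
    (LinearMap.ker (j.lTensor M)).subtype (LinearMap.exact_subtype_ker_map _)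
    (p.lTensor N) (lTensor_exact N hjp hp)
  refine ⟨δ, ?_, ?_⟩
  · refine SnakeLemma.exact_δ_right _ _ _ _ _ _ _ _ _ _ _ _ _ _ _
      (LinearMap.ker (j.lTensor E)).subtype (LinearMap.exact_subtype_ker_map _) _ _ _ _
      (kerMap g j) ?_ (Submodule.subtype_injective _)
    rfl
  · refine SnakeLemma.exact_δ_left _ _ _ _ _ _ _ _ _ _ _ _ _ _ _ _ _ _ _
      (p.lTensor E) (lTensor_exact E hjp hp) (f.rTensor Q) ?_ (LinearMap.lTensor_surjective N hp)
    rw [LinearMap.lTensor_comp_rTensor, LinearMap.rTensor_comp_lTensor]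

/-- `Tor₁` is balanced. -/
lemma nonempty_ker_lTensor_equiv [Module.Flat A P] [Module.Flat A E] (hf : Function.Injective f)
    (hfg : Function.Exact f g) (hg : Function.Surjective g) (hj : Function.Injective j)
    (hjp : Function.Exact j p) (hp : Function.Surjective p) :
    Nonempty (LinearMap.ker (j.lTensor M) ≃ₗ[A] LinearMap.ker (f.rTensor Q)) := by
  obtain ⟨δ, h₁, h₂⟩ := exists_connecting hf hfg hg hjp hp
  -- E is flat and j injective, so the middle kernel vanishes.
  have hinj : Function.Injective δ := by
    rw [injective_iff_map_eq_zero]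
    intro x hx
    obtain ⟨y, rfl⟩ := (h₁ x).1 hx
    have : y = 0 := by
      ext1
      exact Module.Flat.lTensor_preserves_injective_linearMap (M := E) j hj
        (y.2.trans (map_zero _).symm)
    rw [this, map_zero]
  exact ⟨(LinearEquiv.ofInjective δ hinj).trans
    (LinearEquiv.ofEq _ _ (LinearMap.exact_iff.1 h₂).symm)⟩

lemma length_eq_length_ker_add_length_range (f : N →ₗ[A] E) :
    Module.length A N = Module.length A (LinearMap.ker f) + Module.length A (LinearMap.range f) :=
  Module.length_eq_add_of_exact (LinearMap.ker f).subtype f.rangeRestrict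
    (Submodule.subtype_injective _) f.surjective_rangeRestrict
    (by rw [LinearMap.exact_iff, LinearMap.ker_rangeRestrict, Submodule.range_subtype])

/-- The defect of additivity of `Tor₁` in a short exact sequence. -/
theorem length_ker_lTensor_add [Module.Flat A P] (hf : Function.Injective f)
    (hfg : Function.Exact f g) (hg : Function.Surjective g) (hjp : Function.Exact j p)
    (hp : Function.Surjective p) :
    Module.length A (LinearMap.ker (j.lTensor M)) + Module.length A (LinearMap.ker (j.lTensor N)) =
      Module.length A (LinearMap.ker (j.lTensor E)) +
        (Module.length A (LinearMap.ker (f.rTensor Z)) +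
          Module.length A (LinearMap.ker (f.rTensor Q))) := by
  obtain ⟨δ, h₁, h₂⟩ := exists_connecting hf hfg hg hjp hp
  have h₀ : Function.Exact (kerMap f j) (kerMap g j) := by
    intro x
    constructor
    · intro hx
      obtain ⟨y, hy⟩ := (rTensor_exact Z hfg hg x.1).1 (congrArg Subtype.val hx)
      refine ⟨⟨y, ?_⟩, Subtype.ext hy⟩
      apply Module.Flat.rTensor_preserves_injective_linearMap (M := P) f hf
      rw [← LinearMap.comp_apply, LinearMap.rTensor_comp_lTensor,
        ← LinearMap.lTensor_comp_rTensor, LinearMap.comp_apply, hy, map_zero]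
      exact x.2
    · rintro ⟨y, rfl⟩
      exact Subtype.ext ((rTensor_exact Z hfg hg _).2 ⟨y.1, rfl⟩)
  -- Since N ⊗ P → E ⊗ P is injective, ker(N ⊗ Z → E ⊗ Z) already lies in ker(N ⊗ Z → N ⊗ P).
  have hker : Module.length A (LinearMap.ker (kerMap f j)) =
      Module.length A (LinearMap.ker (f.rTensor Z)) := by
    have hle : LinearMap.ker (f.rTensor Z) ≤ LinearMap.ker (j.lTensor N) := by
      intro y hy
      apply Module.Flat.rTensor_preserves_injective_linearMap (M := P) f hf
      rw [← LinearMap.comp_apply, LinearMap.rTensor_comp_lTensor,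
        ← LinearMap.lTensor_comp_rTensor, LinearMap.comp_apply, LinearMap.mem_ker.1 hy, map_zero,
        map_zero]
    have hk : LinearMap.ker (kerMap f j) =
        (LinearMap.ker (f.rTensor Z)).submoduleOf (LinearMap.ker (j.lTensor N)) := by
      ext y
      rw [LinearMap.mem_ker, ← Subtype.coe_inj]
      rfl
    rw [hk]
    exact (Submodule.submoduleOfEquivOfLe hle).length_eq
  rw [length_eq_length_ker_add_length_range δ, length_eq_length_ker_add_length_range (kerMap f j),
    length_eq_length_ker_add_length_range (kerMap g j), LinearMap.exact_iff.1 h₀,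
    LinearMap.exact_iff.1 h₁, LinearMap.exact_iff.1 h₂, hker]
  abel

end Tensor

/-! ### The defect of a pushout, as a function of the map φ. -/

section Pushout

variable {A : Type*} [CommRing A]
  {L F M N E : Type*} [AddCommGroup L] [Module A L] [AddCommGroup F] [Module A F]
  [AddCommGroup M] [Module A M] [AddCommGroup N] [Module A N] [AddCommGroup E] [Module A E]
  (Q : Type*) [AddCommGroup Q] [Module A Q]

/-- In a morphism of short exact sequences which is the identity on the right, the kernel of the
left map tensored with `Q` is the image of the corresponding kernel. -/
theorem ker_rTensor_eq_map {ι : L →ₗ[A] F} {π : F →ₗ[A] M} {f : N →ₗ[A] E} {g : E →ₗ[A] M}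
    {φ : L →ₗ[A] N} {ψ : F →ₗ[A] E} (hιπ : Function.Exact ι π)
    (hπ : Function.Surjective π) (hf : Function.Injective f) (hfg : Function.Exact f g)
    (h₁ : f ∘ₗ φ = ψ ∘ₗ ι) (h₂ : g ∘ₗ ψ = π) :
    LinearMap.ker (f.rTensor Q) = (LinearMap.ker (ι.rTensor Q)).map (φ.rTensor Q) := by
  have h₁' : ∀ l, f (φ l) = ψ (ι l) := fun l => LinearMap.congr_fun h₁ l
  have h₂' : ∀ x, g (ψ x) = π x := fun x => LinearMap.congr_fun h₂ x
  apply le_antisymm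
  -- E is the pushout, so L → N × F → E → 0 is exact and stays so after tensoring with Q. An element
  -- (y, 0) that dies in E ⊗ Q lifts to z with φz = y and ιz = 0.
  · have hex : Function.Exact (φ.prod (-ι)) (f.coprod ψ) := by
      rintro ⟨n, x⟩
      constructor
      · intro h
        simp only [LinearMap.coprod_apply] at h
        have hx : π x = 0 := by
          have := congrArg g h
          rwa [map_add, hfg.apply_apply_eq_zero, zero_add, map_zero, h₂'] at this
        obtain ⟨l, rfl⟩ := (hιπ x).1 hx
        refine ⟨-l, Prod.ext (hf ?_) (by simp)⟩
        change f (φ (-l)) = f n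
        rw [map_neg, map_neg, h₁']
        exact (eq_neg_of_add_eq_zero_left h).symm
      · rintro ⟨l, hl⟩
        rw [← hl]
        change f (φ l) + ψ (-ι l) = 0
        rw [map_neg, h₁', add_neg_cancel]
    have hsurj : Function.Surjective (f.coprod ψ) := by
      intro e
      obtain ⟨x, hx⟩ := hπ (g e)
      obtain ⟨n, hn⟩ := (hfg (e - ψ x)).1 (by rw [map_sub, h₂', hx, sub_self])
      exact ⟨(n, x), by simp [hn]⟩
    intro y hy
    have hy' : (f.coprod ψ).rTensor Q ((LinearMap.inl A N F).rTensor Q y) = 0 := by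
      rw [← LinearMap.comp_apply, ← LinearMap.rTensor_comp, LinearMap.coprod_inl]
      exact hy
    obtain ⟨z, hz⟩ := (rTensor_exact Q hex hsurj _).1 hy'
    have hfst := congrArg ((LinearMap.fst A N F).rTensor Q) hz
    have hsnd := congrArg ((LinearMap.snd A N F).rTensor Q) hz
    simp only [← LinearMap.comp_apply, ← LinearMap.rTensor_comp, LinearMap.fst_prod,
      LinearMap.snd_prod, LinearMap.fst_comp_inl, LinearMap.snd_comp_inl, LinearMap.rTensor_id,
      LinearMap.rTensor_zero, LinearMap.rTensor_neg, LinearMap.id_apply, LinearMap.zero_apply,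
      LinearMap.neg_apply, neg_eq_zero] at hfst hsnd
    exact ⟨z, hsnd, hfst⟩
  · rintro _ ⟨z, hz, rfl⟩
    rw [LinearMap.mem_ker, ← LinearMap.comp_apply, ← LinearMap.rTensor_comp, h₁,
      LinearMap.rTensor_comp, LinearMap.comp_apply, LinearMap.mem_ker.1 hz, map_zero]

/-- The length of the image under `φ ⊗ Q` of the kernel of `ι ⊗ Q`. -/
noncomputable def imgLength (ι : L →ₗ[A] F) (φ : L →ₗ[A] N) : ℕ∞ :=
  Module.length A ((LinearMap.ker (ι.rTensor Q)).map (φ.rTensor Q))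

variable {Q}

lemma length_sup_le (p q : Submodule A N) :
    Module.length A (p ⊔ q : Submodule A N) ≤ Module.length A p + Module.length A q := by
  rw [← Module.length_prod]
  have hr : LinearMap.range (p.subtype.coprod q.subtype) = p ⊔ q := by
    rw [LinearMap.range_coprod, Submodule.range_subtype, Submodule.range_subtype]
  rw [← hr]
  exact Module.length_le_of_surjective _ (LinearMap.surjective_rangeRestrict _)

lemma length_mono {p q : Submodule A N} (h : p ≤ q) : Module.length A p ≤ Module.length A q :=
  Module.length_le_of_injective (Submodule.inclusion h) (Submodule.inclusion_injective h)

variable (ι : L →ₗ[A] F)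

lemma imgLength_zero : imgLength Q ι (0 : L →ₗ[A] N) = 0 := by
  rw [imgLength, LinearMap.rTensor_zero, Submodule.map_zero]
  exact Module.length_bot

lemma imgLength_add_le (φ ψ : L →ₗ[A] N) :
    imgLength Q ι (φ + ψ) ≤ imgLength Q ι φ + imgLength Q ι ψ := by
  refine (length_mono ?_).trans (length_sup_le _ _)
  rw [LinearMap.rTensor_add]
  exact Submodule.map_add_le _ _ _

lemma imgLength_smul_le (a : A) (φ : L →ₗ[A] N) : imgLength Q ι (a • φ) ≤ imgLength Q ι φ := by
  refine length_mono ?_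
  rw [LinearMap.rTensor_smul]
  rintro _ ⟨z, hz, rfl⟩
  exact ⟨a • z, Submodule.smul_mem _ _ hz, by simp⟩

lemma imgLength_smul_eq_zero {a : A} (φ : L →ₗ[A] N)
    (h : ∀ z ∈ LinearMap.ker (ι.rTensor Q), a • z = 0) : imgLength Q ι (a • φ) = 0 := by
  rw [imgLength, LinearMap.rTensor_smul, Module.length_eq_zero_iff,
    Submodule.subsingleton_iff_eq_bot, eq_bot_iff]
  rintro _ ⟨z, hz, rfl⟩
  rw [LinearMap.smul_apply, ← map_smul, h z hz, map_zero]
  exact zero_mem _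

lemma imgLength_ne_top (h : IsFiniteLength A (LinearMap.ker (ι.rTensor Q))) (φ : L →ₗ[A] N) :
    imgLength Q ι φ ≠ ⊤ := by
  rw [imgLength, Module.length_ne_top_iff]
  exact h.of_surjective (f := (φ.rTensor Q).submoduleMap _) (LinearMap.submoduleMap_surjective _ _)

end Pushout

end TSplit

namespace TSplit

open TensorProduct

/-! ### Comparison with the derived functor. -/

section Tor

variable {A : Type u} [CommRing A]

/-- The homology of `X → Y → W` when `Y → W` is a cokernel of `X → Y` followed by `j`. -/
lemma nonempty_homology_equiv (S : ShortComplex (ModuleCat.{u} A)) {C : Type u} [AddCommGroup C]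
    [Module A C] (c : S.X₂ →ₗ[A] C) (j : C →ₗ[A] S.X₃) (hc : Function.Surjective c)
    (hex : Function.Exact S.f.hom c) (hj : j ∘ₗ c = S.g.hom) :
    Nonempty (S.homology ≃ₗ[A] LinearMap.ker j) := by
  have hjc : ∀ x, j (c x) = S.g.hom x := fun x => LinearMap.congr_fun hj x
  let φ : LinearMap.ker S.g.hom →ₗ[A] LinearMap.ker j :=
    c.restrict fun x hx => by rw [LinearMap.mem_ker, hjc]; exact hx
  have hφ : Function.Surjective φ := by
    rintro ⟨y, hy⟩
    obtain ⟨x, rfl⟩ := hc y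
    exact ⟨⟨x, by rw [LinearMap.mem_ker, ← hjc]; exact hy⟩, rfl⟩
  have hk : LinearMap.range S.moduleCatToCycles = LinearMap.ker φ := by
    ext x
    rw [LinearMap.mem_ker, ← Subtype.coe_inj]
    refine Iff.trans ?_ (hex x.1).symm
    exact ⟨fun ⟨y, hy⟩ => ⟨y, congrArg Subtype.val hy⟩, fun ⟨y, hy⟩ => ⟨y, Subtype.ext hy⟩⟩
  exact ⟨S.moduleCatHomologyIso.toLinearEquiv.trans
    ((Submodule.quotEquivOfEq _ _ hk).trans (φ.quotKerEquivOfSurjective hφ))⟩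

/-- `Tor₁(M, Y)` computed from a flat presentation of `M`. -/
theorem nonempty_tor_equiv (M Y : ModuleCat.{u} A) {L F : Type u} [AddCommGroup L] [Module A L]
    [AddCommGroup F] [Module A F] [Module.Flat A F] {ι : L →ₗ[A] F} {π : F →ₗ[A] M}
    (hι : Function.Injective ι) (hιπ : Function.Exact ι π) (hπ : Function.Surjective π) :
    Nonempty (((Tor (ModuleCat.{u} A) 1).obj M).obj Y ≃ₗ[A] LinearMap.ker (ι.rTensor Y)) := by
  -- `Tor` is derived in its second variable, so a resolution of Y computes it; balance then passes
  -- to the presentation of M.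
  let R := projectiveResolution Y
  let T := (MonoidalCategory.tensoringLeft (ModuleCat.{u} A)).obj M
  let K := (T.mapHomologicalComplex _).obj R.complex
  let e₁ : ((Tor (ModuleCat.{u} A) 1).obj M).obj Y ≅ (K.sc' 2 1 0).homology :=
    R.isoLeftDerivedObj T 1 ≪≫ K.homologyIsoSc' 2 1 0 (by simp) (by simp)
  let d₁ := (R.complex.d 1 0).hom
  let d₂ := (R.complex.d 2 1).hom
  have hex : Function.Exact d₂ d₁ :=
    (ShortComplex.ShortExact.moduleCat_exact_iff_function_exact _).1 (R.exact_succ 0)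
  let j := (LinearMap.range d₁).subtype
  have hex' : Function.Exact d₂ d₁.rangeRestrict := by
    rw [LinearMap.exact_iff, LinearMap.ker_rangeRestrict]
    exact LinearMap.exact_iff.1 hex
  have hsurj := d₁.surjective_rangeRestrict
  have hcomp : j.lTensor M ∘ₗ d₁.rangeRestrict.lTensor M = d₁.lTensor M := by
    rw [← LinearMap.lTensor_comp]
    rfl
  obtain ⟨e₂⟩ := nonempty_homology_equiv (K.sc' 2 1 0) (d₁.rangeRestrict.lTensor M)
    (j.lTensor M) (LinearMap.lTensor_surjective _ hsurj) (lTensor_exact M hex' hsurj) hcomp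
  let i := HomologicalComplex.singleObjXSelf (ComplexShape.down ℕ) 0 Y
  let p : R.complex.X 0 →ₗ[A] Y := i.toLinearEquiv.toLinearMap ∘ₗ (R.π.f 0).hom
  have hp : Function.Surjective p :=
    i.toLinearEquiv.surjective.comp ((ModuleCat.epi_iff_surjective _).1 inferInstance)
  have hjp : Function.Exact j p := by
    have h := (ShortComplex.ShortExact.moduleCat_exact_iff_function_exact _).1 R.exact₀
    intro x
    refine Iff.trans ?_ ((h x).trans ?_)
    · exact i.toLinearEquiv.map_eq_zero_iff
    · exact ⟨fun ⟨y, hy⟩ => ⟨⟨x, y, hy⟩, rfl⟩, fun ⟨⟨z, y, hy⟩, hz⟩ => ⟨y, hy.trans hz⟩⟩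
  have : Module.Projective A (R.complex.X 0) :=
    (IsProjective.iff_projective _).2 (R.projective 0)
  obtain ⟨e₃⟩ := nonempty_ker_lTensor_equiv hι hιπ hπ (Submodule.subtype_injective _) hjp hp
  exact ⟨(e₁.toLinearEquiv.trans e₂).trans e₃⟩

end Tor

/-! ### Tensoring with A/I, uniform annihilation, and existence of the limit. -/

section Ideal

variable {A : Type*} [CommRing A] {V : Type*} [AddCommGroup V] [Module A V]

lemma tmul_one_eq_zero_iff (I : Ideal A) (v : V) :
    v ⊗ₜ[A] (1 : A ⧸ I) = 0 ↔ v ∈ I • (⊤ : Submodule A V) := by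
  rw [← tensorQuotEquivQuotSMul_symm_mk, LinearEquiv.map_eq_zero_iff,
    Submodule.Quotient.mk_eq_zero]

lemma exists_tmul_one_eq (I : Ideal A) (z : V ⊗[A] (A ⧸ I)) : ∃ v : V, v ⊗ₜ[A] 1 = z := by
  obtain ⟨v, hv⟩ := Submodule.mkQ_surjective _ (tensorQuotEquivQuotSMul V I z)
  exact ⟨v, by rw [← tensorQuotEquivQuotSMul_symm_mk, LinearEquiv.symm_apply_eq]; exact hv⟩

lemma mem_smul_top_subtype (I : Ideal A) (L : Submodule A V) (x : L) :
    x ∈ I • (⊤ : Submodule A L) ↔ (x : V) ∈ I • L := by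
  have : (I • (⊤ : Submodule A L)).map L.subtype = I • L := by
    rw [Submodule.map_smul'', Submodule.map_subtype_top]
  rw [← this]
  exact ⟨fun h => ⟨x, h, rfl⟩, fun ⟨y, hy, hyx⟩ => Subtype.ext hyx ▸ hy⟩

/-- `(I V ⊓ L) / I L` is the kernel of `L / I L → V / I V`. -/
theorem nonempty_inf_quotient_equiv (I : Ideal A) (L : Submodule A V) :
    Nonempty ((↥(I • ⊤ ⊓ L) ⧸ (I • L).submoduleOf (I • ⊤ ⊓ L)) ≃ₗ[A]
      LinearMap.ker (L.subtype.rTensor (A ⧸ I))) := by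
  let φ : ↥(I • ⊤ ⊓ L) →ₗ[A] L ⊗[A] (A ⧸ I) :=
    (TensorProduct.mk A L (A ⧸ I)).flip 1 ∘ₗ Submodule.inclusion inf_le_right
  have hφ : ∀ x, φ x = Submodule.inclusion inf_le_right x ⊗ₜ 1 := fun x => rfl
  have hr : LinearMap.range φ = LinearMap.ker (L.subtype.rTensor (A ⧸ I)) := by
    ext z
    obtain ⟨v, rfl⟩ := exists_tmul_one_eq I z
    rw [LinearMap.mem_ker, LinearMap.rTensor_tmul, tmul_one_eq_zero_iff]
    constructor
    · rintro ⟨x, hx⟩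
      have h := congrArg (L.subtype.rTensor (A ⧸ I)) hx
      rw [hφ, LinearMap.rTensor_tmul, LinearMap.rTensor_tmul] at h
      rw [← tmul_one_eq_zero_iff, ← h, tmul_one_eq_zero_iff]
      exact x.2.1
    · intro hv
      exact ⟨⟨v, hv, v.2⟩, rfl⟩
  have hk : (I • L).submoduleOf (I • ⊤ ⊓ L) = LinearMap.ker φ := by
    ext x
    rw [LinearMap.mem_ker, hφ, tmul_one_eq_zero_iff, mem_smul_top_subtype]
    rfl
  exact ⟨(Submodule.quotEquivOfEq _ _ hk).trans
    (φ.quotKerEquivRange.trans (LinearEquiv.ofEq _ _ hr))⟩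

end Ideal

section Local

variable {A : Type u} [CommRing A] [IsLocalRing A] [IsNoetherianRing A]

open IsLocalRing

/-- A power of the maximal ideal kills the kernels of `L / 𝔪ⁿ L → V / 𝔪ⁿ V` for all `n`. -/
lemma exists_pow_smul_ker_rTensor {V : Type*} [AddCommGroup V] [Module A V] [Module.Finite A V]
    (L : Submodule A V) : ∃ k : ℕ, ∀ n, ∀ a ∈ maximalIdeal A ^ k,
      ∀ z ∈ LinearMap.ker (L.subtype.rTensor (A ⧸ maximalIdeal A ^ n)), a • z = 0 := by
  obtain ⟨k, hk, -⟩ := exists_pow_smul_inf_le L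
  refine ⟨k, fun n a ha z hz => ?_⟩
  obtain ⟨v, rfl⟩ := exists_tmul_one_eq _ z
  rw [TensorProduct.smul_tmul', tmul_one_eq_zero_iff, mem_smul_top_subtype]
  exact hk n (Submodule.smul_mem_smul ha ⟨(tmul_one_eq_zero_iff _ (v : V)).1 hz, v.2⟩)

/-- A power of the maximal ideal kills the kernels of `X ⊗ 𝔪ⁿ → X` for all `n`. -/
lemma exists_pow_smul_ker_lTensor (X : Type u) [AddCommGroup X] [Module A X] [Module.Finite A X] :
    ∃ k : ℕ, ∀ n, ∀ a ∈ maximalIdeal A ^ k,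
      ∀ z ∈ LinearMap.ker ((maximalIdeal A ^ n).subtype.lTensor X), a • z = 0 := by
  obtain ⟨F, _, _, _, _, π, hπ⟩ := Module.exists_finite_presentation A X
  obtain ⟨k, hk⟩ := exists_pow_smul_ker_rTensor (LinearMap.ker π)
  refine ⟨k, fun n a ha z hz => ?_⟩
  -- Balance turns this kernel into that of ker π ⊗ A/𝔪ⁿ → F ⊗ A/𝔪ⁿ, where Artin–Rees applies.
  obtain ⟨e⟩ := nonempty_ker_lTensor_equiv (Submodule.subtype_injective (LinearMap.ker π))
    (LinearMap.exact_subtype_ker_map π) hπ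
    (Submodule.subtype_injective (maximalIdeal A ^ n)) (LinearMap.exact_subtype_mkQ _)
    (Submodule.mkQ_surjective _)
  have h : a • (⟨z, hz⟩ : LinearMap.ker ((maximalIdeal A ^ n).subtype.lTensor X)) = 0 := by
    apply e.injective
    rw [map_smul, map_zero]
    exact Subtype.ext (hk n a ha _ (e ⟨z, hz⟩).2)
  exact congrArg Subtype.val h

/-- A power of the maximal ideal kills the kernels of `L ⊗ 𝔪ⁿ → V ⊗ 𝔪ⁿ` for all `n`. -/
lemma exists_pow_smul_ker_rTensor_pow {V : Type u} [AddCommGroup V] [Module A V] [Module.Finite A V]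
    (L : Submodule A V) : ∃ k : ℕ, ∀ n, ∀ a ∈ maximalIdeal A ^ k,
      ∀ z ∈ LinearMap.ker (L.subtype.rTensor ↥(maximalIdeal A ^ n)), a • z = 0 := by
  obtain ⟨k, hk⟩ := exists_pow_smul_ker_lTensor (A := A) L
  refine ⟨k, fun n a ha z hz => hk n a ha z ?_⟩
  -- L ⊗ A → V ⊗ A is injective, so the kernel lies in ker(L ⊗ 𝔪ⁿ → L ⊗ A).
  apply Module.Flat.rTensor_preserves_injective_linearMap (M := A) L.subtype
    (Submodule.subtype_injective _)
  rw [← LinearMap.comp_apply, LinearMap.rTensor_comp_lTensor, ← LinearMap.lTensor_comp_rTensor,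
    LinearMap.comp_apply, LinearMap.mem_ker.1 hz, map_zero, map_zero]

/-- The limit defining `e^T` exists for every finitely generated module. -/
theorem exists_hasET (hd : 1 ≤ dim A) (M : ModuleCat.{u} A) [Module.Finite A M] :
    ∃ e, HasET A M e := by
  obtain ⟨F, _, _, _, _, π, hπ⟩ := Module.exists_finite_presentation A M
  obtain ⟨e, he⟩ := exists_tendsto_inf_pow_smul hd (LinearMap.ker π)
  refine ⟨e, he.congr fun n => ?_⟩
  obtain ⟨e₁⟩ := nonempty_tor_equiv M (ModuleCat.of A (A ⧸ maximalIdeal A ^ (n + 1)))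
    (Submodule.subtype_injective (LinearMap.ker π)) (LinearMap.exact_subtype_ker_map π) hπ
  obtain ⟨e₂⟩ := nonempty_inf_quotient_equiv (maximalIdeal A ^ (n + 1)) (LinearMap.ker π)
  have h := LinearEquiv.length_eq (e₂.trans e₁.symm)
  rw [torLength, relLength, h]

end Local

end TSplit

namespace TSplit

open TensorProduct IsLocalRing

/-! ### The defect and the submodule of negligible maps. -/

section Length

variable {A : Type u} [CommRing A] [IsLocalRing A]

/-- Resolving A/𝔪ⁿ⁺¹ by A, rather than X, gives a form functorial in X, as the long exact sequence
requires. -/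
lemma torLength_eq (X : ModuleCat.{u} A) [Module.Finite A X] (n : ℕ) :
    torLength A X n =
      (Module.length A (LinearMap.ker ((maximalIdeal A ^ (n + 1)).subtype.lTensor X))).toNat := by
  obtain ⟨F, _, _, _, _, π, hπ⟩ := Module.exists_finite_presentation A X
  obtain ⟨e₁⟩ := nonempty_tor_equiv X (ModuleCat.of A (A ⧸ maximalIdeal A ^ (n + 1)))
    (Submodule.subtype_injective (LinearMap.ker π)) (LinearMap.exact_subtype_ker_map π) hπ
  obtain ⟨e₂⟩ := nonempty_ker_lTensor_equiv (Submodule.subtype_injective (LinearMap.ker π))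
    (LinearMap.exact_subtype_ker_map π) hπ
    (Submodule.subtype_injective (maximalIdeal A ^ (n + 1))) (LinearMap.exact_subtype_mkQ _)
    (Submodule.mkQ_surjective _)
  have h := LinearEquiv.length_eq (e₂.trans e₁.symm)
  rw [torLength, h]

variable {F N : Type u} [AddCommGroup F] [Module A F] [AddCommGroup N] [Module A N]
  {L : Submodule A F}

/-- The defect of additivity of `ℓ(Tor₁(-, A/𝔪ⁿ⁺¹))` on the pushout along `φ : L → N` of the
extension `0 → L → F → F / L → 0`. -/
noncomputable def defect (φ : L →ₗ[A] N) (n : ℕ) : ℕ :=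
  (imgLength ↥(maximalIdeal A ^ (n + 1)) L.subtype φ).toNat +
    (imgLength (A ⧸ maximalIdeal A ^ (n + 1)) L.subtype φ).toNat

lemma defect_zero (n : ℕ) : defect (0 : L →ₗ[A] N) n = 0 := by
  simp [defect, imgLength_zero]

variable [IsNoetherianRing A]

lemma isFiniteLength_ker_lTensor (X : Type u) [AddCommGroup X] [Module A X] [Module.Finite A X]
    (n : ℕ) : IsFiniteLength A (LinearMap.ker ((maximalIdeal A ^ n).subtype.lTensor X)) := by
  obtain ⟨k, hk⟩ := exists_pow_smul_ker_lTensor (A := A) X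
  exact isFiniteLength_of_pow_smul k fun a ha z => Subtype.ext (hk n a ha z z.2)

variable [Module.Finite A F]

/-- Finiteness matters because `toNat` sends ⊤ to 0, which would break monotonicity and additivity.
-/
lemma imgLength_pow_ne_top (φ : L →ₗ[A] N) (n : ℕ) :
    imgLength ↥(maximalIdeal A ^ n) L.subtype φ ≠ ⊤ := by
  obtain ⟨k, hk⟩ := exists_pow_smul_ker_rTensor_pow L
  exact imgLength_ne_top _
    (isFiniteLength_of_pow_smul k fun a ha z => Subtype.ext (hk n a ha z z.2)) φ

lemma imgLength_quotient_ne_top (φ : L →ₗ[A] N) (n : ℕ) :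
    imgLength (A ⧸ maximalIdeal A ^ n) L.subtype φ ≠ ⊤ := by
  obtain ⟨k, hk⟩ := exists_pow_smul_ker_rTensor L
  exact imgLength_ne_top _
    (isFiniteLength_of_pow_smul k fun a ha z => Subtype.ext (hk n a ha z z.2)) φ

lemma defect_add_le (φ ψ : L →ₗ[A] N) (n : ℕ) :
    defect (φ + ψ) n ≤ defect φ n + defect ψ n := by
  have h₁ := ENat.toNat_le_toNat
    (imgLength_add_le (Q := ↥(maximalIdeal A ^ (n + 1))) L.subtype φ ψ)
    (WithTop.add_ne_top.2 ⟨imgLength_pow_ne_top φ _, imgLength_pow_ne_top ψ _⟩)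
  have h₂ := ENat.toNat_le_toNat
    (imgLength_add_le (Q := A ⧸ maximalIdeal A ^ (n + 1)) L.subtype φ ψ)
    (WithTop.add_ne_top.2 ⟨imgLength_quotient_ne_top φ _, imgLength_quotient_ne_top ψ _⟩)
  rw [ENat.toNat_add (imgLength_pow_ne_top φ _) (imgLength_pow_ne_top ψ _)] at h₁
  rw [ENat.toNat_add (imgLength_quotient_ne_top φ _) (imgLength_quotient_ne_top ψ _)] at h₂
  unfold defect
  omega

lemma defect_smul_le (a : A) (φ : L →ₗ[A] N) (n : ℕ) : defect (a • φ) n ≤ defect φ n :=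
  add_le_add (ENat.toNat_le_toNat (imgLength_smul_le _ a φ) (imgLength_pow_ne_top φ _))
    (ENat.toNat_le_toNat (imgLength_smul_le _ a φ) (imgLength_quotient_ne_top φ _))

-- By Artin–Rees, k depends neither on n nor on φ; this uniformity yields the finite length of the
-- quotient.
variable (N L) in
lemma exists_defect_smul_eq_zero : ∃ k : ℕ, ∀ a ∈ maximalIdeal A ^ k, ∀ (φ : L →ₗ[A] N) (n : ℕ),
    defect (a • φ) n = 0 := by
  obtain ⟨k₁, h₁⟩ := exists_pow_smul_ker_rTensor_pow L
  obtain ⟨k₂, h₂⟩ := exists_pow_smul_ker_rTensor L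
  refine ⟨k₁ + k₂, fun a ha φ n => ?_⟩
  rw [defect, imgLength_smul_eq_zero _ φ (h₁ (n + 1) a (Ideal.pow_le_pow_right (by omega) ha)),
    imgLength_smul_eq_zero _ φ (h₂ (n + 1) a (Ideal.pow_le_pow_right (by omega) ha))]
  rfl

/-- The homomorphisms with asymptotically negligible defect. -/
noncomputable def negligible (L : Submodule A F) (N : Type u) [AddCommGroup N] [Module A N] :
    Submodule A (L →ₗ[A] N) where
  carrier := {φ | Tendsto (fun n : ℕ => ((dim A - 1).factorial : ℝ) / (n : ℝ) ^ (dim A - 1) *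
    (defect φ n : ℝ)) atTop (𝓝 0)}
  zero_mem' := by simp [defect_zero]
  add_mem' {φ ψ} hφ hψ := by
    refine squeeze_zero (fun n => by positivity) (fun n => ?_) (by simpa using hφ.add hψ)
    rw [← mul_add]
    gcongr
    exact_mod_cast defect_add_le φ ψ n
  smul_mem' a φ hφ := by
    refine squeeze_zero (fun n => by positivity) (fun n => ?_) hφ
    gcongr
    exact defect_smul_le a φ n

lemma mem_negligible {φ : L →ₗ[A] N} : φ ∈ negligible L N ↔
    Tendsto (fun n : ℕ => ((dim A - 1).factorial : ℝ) / (n : ℝ) ^ (dim A - 1) *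
      (defect φ n : ℝ)) atTop (𝓝 0) := Iff.rfl

/-- Additivity of the length of `Tor₁` up to the defect. -/
lemma torLength_add {M N E : ModuleCat.{u} A} [Module.Finite A M] [Module.Finite A N]
    [Module.Finite A E] {π : F →ₗ[A] M} (hπ : Function.Surjective π) {f : N →ₗ[A] E}
    {g : E →ₗ[A] M} (hf : Function.Injective f) (hfg : Function.Exact f g)
    (hg : Function.Surjective g) {φ : LinearMap.ker π →ₗ[A] N} {ψ : F →ₗ[A] E}
    (h₁ : f ∘ₗ φ = ψ ∘ₗ (LinearMap.ker π).subtype) (h₂ : g ∘ₗ ψ = π) (n : ℕ) :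
    torLength A M n + torLength A N n = torLength A E n + defect φ n := by
  have h := length_ker_lTensor_add hf hfg hg
    (LinearMap.exact_subtype_mkQ (maximalIdeal A ^ (n + 1))) (Submodule.mkQ_surjective _)
  have e := fun (Q : Type u) [AddCommGroup Q] [Module A Q] =>
    congrArg (fun p : Submodule A (N ⊗[A] Q) => Module.length A p)
      (ker_rTensor_eq_map Q (LinearMap.exact_subtype_ker_map π) hπ hf hfg h₁ h₂)
  have e₁ : _ = imgLength _ (LinearMap.ker π).subtype φ := e ↥(maximalIdeal A ^ (n + 1))
  have e₂ : _ = imgLength _ (LinearMap.ker π).subtype φ := e (A ⧸ maximalIdeal A ^ (n + 1))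
  have hfin := fun (X : Type u) [AddCommGroup X] [Module A X] [Module.Finite A X] =>
    Module.length_ne_top_iff.2 (isFiniteLength_ker_lTensor (A := A) X (n + 1))
  rw [e₁, e₂] at h
  replace h := congrArg ENat.toNat h
  have i₁ := imgLength_pow_ne_top φ (n + 1)
  have i₂ := imgLength_quotient_ne_top φ (n + 1)
  have i₃ : imgLength ↥(maximalIdeal A ^ (n + 1)) (LinearMap.ker π).subtype φ +
      imgLength (A ⧸ maximalIdeal A ^ (n + 1)) (LinearMap.ker π).subtype φ ≠ ⊤ :=
    WithTop.add_ne_top.2 ⟨i₁, i₂⟩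
  rw [ENat.toNat_add (hfin M) (hfin N), ENat.toNat_add (hfin E) i₃, ENat.toNat_add i₁ i₂] at h
  rw [torLength_eq, torLength_eq, torLength_eq, h, defect]

/-- The normalized defect converges to eM + eN - eE, and limits are unique. -/
lemma mem_negligible_iff {M N E : ModuleCat.{u} A} [Module.Finite A M] [Module.Finite A N]
    [Module.Finite A E] {π : F →ₗ[A] M} (hπ : Function.Surjective π) {f : N →ₗ[A] E}
    {g : E →ₗ[A] M} (hf : Function.Injective f) (hfg : Function.Exact f g)
    (hg : Function.Surjective g) {φ : LinearMap.ker π →ₗ[A] N} {ψ : F →ₗ[A] E}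
    (h₁ : f ∘ₗ φ = ψ ∘ₗ (LinearMap.ker π).subtype) (h₂ : g ∘ₗ ψ = π) {eM eN eE : ℝ}
    (hM : HasET A M eM) (hN : HasET A N eN) (hE : HasET A E eE) :
    φ ∈ negligible (LinearMap.ker π) N ↔ eM + eN - eE = 0 := by
  have ht : Tendsto (fun n : ℕ => ((dim A - 1).factorial : ℝ) / (n : ℝ) ^ (dim A - 1) *
      (defect φ n : ℝ)) atTop (𝓝 (eM + eN - eE)) := by
    refine ((hM.add hN).sub hE).congr fun n => ?_
    have h : (torLength A M n : ℝ) + torLength A N n = torLength A E n + defect φ n := by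
      exact_mod_cast torLength_add hπ hf hfg hg h₁ h₂ n
    rw [← mul_add, ← mul_sub, h, add_sub_cancel_left]
  rw [mem_negligible]
  exact ⟨fun h => tendsto_nhds_unique ht h, fun h => h ▸ ht⟩

end Length

/-! ### Extension classes as pushouts. -/

section Ext

variable {A : Type u} [CommRing A] {F : Type u} [AddCommGroup F] [Module A F]

/-- The map `Hom(ker π, N) → Ext¹(M, N)` given by pushing out `0 → ker π → F → M → 0`. -/
noncomputable def pushoutClass {M : ModuleCat.{u} A} {π : F →ₗ[A] M} (hπ : Function.Surjective π)
    (N : ModuleCat.{u} A) : (LinearMap.ker π →ₗ[A] N) →ₗ[A] Abelian.Ext.{u} M N 1 where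
  toFun φ := (LinearMap.shortExact_shortComplexKer hπ).extClass.comp
    (Abelian.Ext.mk₀ (ModuleCat.ofHom φ)) (add_zero 1)
  map_add' φ ψ := by
    rw [ModuleCat.ofHom_add, Abelian.Ext.mk₀_add, Abelian.Ext.comp_add]
  map_smul' a φ := by
    rw [show ModuleCat.ofHom (a • φ) = a • ModuleCat.ofHom φ from rfl, Abelian.Ext.mk₀_smul,
      Abelian.Ext.comp_smul, RingHom.id_apply]

variable {M N E : ModuleCat.{u} A} {π : F →ₗ[A] M}

/-- Ext¹(F, N) = 0 in the long exact sequence, F being projective. -/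
lemma pushoutClass_surjective [Module.Projective A F] (hπ : Function.Surjective π) :
    Function.Surjective (pushoutClass hπ N) := by
  intro α
  have : Projective π.shortComplexKer.X₂ :=
    (IsProjective.iff_projective F).1 inferInstance
  obtain ⟨x, hx⟩ := precomp_extClass_surjective_of_projective_X₂ N
    (LinearMap.shortExact_shortComplexKer hπ) 0 α
  obtain ⟨φ, rfl⟩ := (Abelian.Ext.mk₀_bijective _ _).2 x
  exact ⟨φ.hom, hx⟩

/-- Naturality of the extension class under a morphism of short exact sequences that is the identity
on M. -/
lemma pushoutClass_eq_extClass (hπ : Function.Surjective π) {f : N ⟶ E} {g : E ⟶ M}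
    {w : f ≫ g = 0} (hS : (ShortComplex.mk f g w).ShortExact) {φ : LinearMap.ker π →ₗ[A] N}
    {ψ : F →ₗ[A] E} (h₁ : f.hom ∘ₗ φ = ψ ∘ₗ (LinearMap.ker π).subtype) (h₂ : g.hom ∘ₗ ψ = π) :
    pushoutClass hπ N φ = hS.extClass := by
  let τ : π.shortComplexKer ⟶ ShortComplex.mk f g w :=
    { τ₁ := ModuleCat.ofHom φ
      τ₂ := ModuleCat.ofHom ψ
      τ₃ := 𝟙 M
      comm₁₂ := ModuleCat.hom_ext h₁
      comm₂₃ := ModuleCat.hom_ext h₂ }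
  have h := ShortComplex.ShortExact.extClass_naturality
    (LinearMap.shortExact_shortComplexKer hπ) hS τ
  exact h.trans (Abelian.Ext.mk₀_id_comp _)

/-- A free presentation maps to every extension. -/
lemma exists_pushout_square [Module.Projective A F] {f : N →ₗ[A] E} {g : E →ₗ[A] M}
    (hf : Function.Injective f) (hfg : Function.Exact f g) (hg : Function.Surjective g) :
    ∃ (φ : LinearMap.ker π →ₗ[A] N) (ψ : F →ₗ[A] E),
      f ∘ₗ φ = ψ ∘ₗ (LinearMap.ker π).subtype ∧ g ∘ₗ ψ = π := by
  obtain ⟨ψ, hψ⟩ := Module.projective_lifting_property g π hg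
  have hr : ∀ x : LinearMap.ker π, ψ x ∈ LinearMap.range f := fun x =>
    (hfg (ψ x)).1 ((LinearMap.congr_fun hψ x).trans x.2)
  refine ⟨(LinearEquiv.ofInjective f hf).symm.toLinearMap ∘ₗ
    (ψ ∘ₗ (LinearMap.ker π).subtype).codRestrict _ hr, ψ, ?_, hψ⟩
  ext x
  exact congrArg Subtype.val ((LinearEquiv.ofInjective f hf).apply_symm_apply ⟨ψ x, hr x⟩)

/-- The pushout of `0 → ker π → F → M → 0` along any map is an extension. -/
lemma exists_extension [IsNoetherianRing A] [Module.Finite A F] [Module.Finite A N]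
    (hπ : Function.Surjective π) (φ : LinearMap.ker π →ₗ[A] N) :
    ∃ (E : ModuleCat.{u} A) (f : N →ₗ[A] E) (g : E →ₗ[A] M) (ψ : F →ₗ[A] E),
      Module.Finite A E ∧ Function.Injective f ∧ Function.Exact f g ∧ Function.Surjective g ∧
        f ∘ₗ φ = ψ ∘ₗ (LinearMap.ker π).subtype ∧ g ∘ₗ ψ = π := by
  -- E is N × F modulo the pairs (φ l, -l).
  let W : Submodule A (N × F) := LinearMap.range (φ.prod (-(LinearMap.ker π).subtype))
  have hW : ∀ x, W.mkQ x = 0 ↔ ∃ l : LinearMap.ker π, (φ l, -(l : F)) = x := fun x =>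
    Submodule.Quotient.mk_eq_zero W
  have hWπ : W ≤ LinearMap.ker (π ∘ₗ LinearMap.snd A N F) := by
    rintro _ ⟨l, rfl⟩
    change π (-(l : F)) = 0
    rw [map_neg, LinearMap.mem_ker.1 l.2, neg_zero]
  refine ⟨ModuleCat.of A ((N × F) ⧸ W), W.mkQ ∘ₗ LinearMap.inl A N F,
    W.liftQ (π ∘ₗ LinearMap.snd A N F) hWπ, W.mkQ ∘ₗ LinearMap.inr A N F,
    inferInstanceAs (Module.Finite A ((N × F) ⧸ W)), ?_, ?_, ?_, ?_, ?_⟩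
  · rw [injective_iff_map_eq_zero]
    intro n hn
    obtain ⟨l, hl⟩ := (hW _).1 hn
    have hl0 : l = 0 := Subtype.ext (neg_eq_zero.1 (congrArg Prod.snd hl))
    have := congrArg Prod.fst hl
    rw [hl0, map_zero] at this
    exact this.symm
  · intro x
    obtain ⟨⟨n, x⟩, rfl⟩ := W.mkQ_surjective x
    constructor
    · intro hx
      refine ⟨n + φ ⟨x, hx⟩, ?_⟩
      rw [LinearMap.comp_apply, ← sub_eq_zero, ← map_sub, hW]
      exact ⟨⟨x, hx⟩, by simp⟩
    · rintro ⟨n', hn'⟩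
      rw [← hn']
      exact map_zero π
  · intro m
    obtain ⟨x, rfl⟩ := hπ m
    exact ⟨W.mkQ (0, x), rfl⟩
  · ext l
    change W.mkQ (φ l, 0) = W.mkQ (0, (l : F))
    rw [← sub_eq_zero, ← map_sub, hW]
    exact ⟨l, by simp⟩
  · rfl

end Ext

end TSplit

/-! ### Conclusion. -/

theorem theorem4p1 (A : Type u) [CommRing A] [IsLocalRing A]
    (hA : TSplit.IsCohenMacaulay A) (hd : 1 ≤ ringKrullDim A)
    (M N : ModuleCat.{u} A) (hM : TSplit.IsMCM A M) (hN : TSplit.IsMCM A N) :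
    ∃ T : Submodule A (CategoryTheory.Abelian.Ext.{u} M N 1),
      (∀ α : CategoryTheory.Abelian.Ext.{u} M N 1, α ∈ T ↔ TSplit.IsTSplit α) ∧
      IsFiniteLength A (CategoryTheory.Abelian.Ext.{u} M N 1 ⧸ T) := by
  have := hA.1
  have := hM.1
  have := hN.1
  have hd' : 1 ≤ TSplit.dim A := by
    have h : 1 ≤ (IsLocalRing.maximalIdeal A).height := by
      rw [← IsLocalRing.maximalIdeal_height_eq_ringKrullDim] at hd
      exact_mod_cast hd
    rw [TSplit.dim, ← IsLocalRing.maximalIdeal_height_eq_ringKrullDim]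
    exact ENat.toNat_le_toNat h (Ideal.height_ne_top (Ideal.IsPrime.ne_top inferInstance))
  obtain ⟨F, _, _, _, _, π, hπ⟩ := Module.exists_finite_presentation A M
  obtain ⟨eM, heM⟩ := TSplit.exists_hasET hd' M
  obtain ⟨eN, heN⟩ := TSplit.exists_hasET hd' N
  refine ⟨(TSplit.negligible (LinearMap.ker π) N).map (TSplit.pushoutClass hπ N),
    fun α => ⟨?_, ?_⟩, ?_⟩
  · rintro ⟨φ, hφ, rfl⟩
    obtain ⟨E, f, g, ψ, hE, hf, hfg, hg, h₁, h₂⟩ := TSplit.exists_extension hπ φ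
    obtain ⟨eE, heE⟩ := TSplit.exists_hasET hd' E
    have w : ModuleCat.ofHom f ≫ ModuleCat.ofHom g = 0 :=
      ModuleCat.hom_ext hfg.linearMap_comp_eq_zero
    have hS : (ShortComplex.mk (ModuleCat.ofHom f) (ModuleCat.ofHom g) w).ShortExact :=
      ModuleCat.shortComplex_shortExact _ hfg hf hg
    exact ⟨E, _, _, w, hS, (TSplit.pushoutClass_eq_extClass hπ hS h₁ h₂).symm, eM, eN, eE,
      heM, heN, heE, (TSplit.mem_negligible_iff hπ hf hfg hg h₁ h₂ heM heN heE).1 hφ⟩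
  · rintro ⟨E, f, g, w, hS, rfl, eM, eN, eE, heM, heN, heE, h0⟩
    have hf := hS.moduleCat_injective_f
    have hg := hS.moduleCat_surjective_g
    have hfg := (ShortComplex.ShortExact.moduleCat_exact_iff_function_exact _).1 hS.exact
    obtain ⟨φ, ψ, h₁, h₂⟩ := TSplit.exists_pushout_square (π := π) hf hfg hg
    have : Module.Finite A E := Module.Finite.of_exact hfg hg
    exact ⟨φ, (TSplit.mem_negligible_iff hπ hf hfg hg h₁ h₂ heM heN heE).2 h0,
      TSplit.pushoutClass_eq_extClass hπ hS h₁ h₂⟩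
  · obtain ⟨k, hk⟩ := TSplit.exists_defect_smul_eq_zero N (LinearMap.ker π)
    -- Ext¹(M, N) is a quotient of the finitely generated module Hom(ker π, N), so being killed by
    -- 𝔪ᵏ suffices.
    have := Module.Finite.of_surjective _ (TSplit.pushoutClass_surjective (N := N) hπ)
    refine TSplit.isFiniteLength_of_pow_smul k fun a ha x => ?_
    obtain ⟨x, rfl⟩ := Submodule.mkQ_surjective _ x
    obtain ⟨φ, rfl⟩ := TSplit.pushoutClass_surjective hπ x
    rw [← map_smul, ← map_smul, Submodule.mkQ_apply, Submodule.Quotient.mk_eq_zero]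
    refine ⟨a • φ, ?_, rfl⟩
    rw [SetLike.mem_coe, TSplit.mem_negligible]
    simp [hk a ha φ]
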